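/- All Banach spaces are real. A set algebra is a family $\mathcal F$ of subsets of some set $\Omega$ that contains $\varnothing$ and is closed under complementation in $\Omega$ and under finite unions; a vector measure is a finitely additive function $\mu\colon\mathcal F\to X$, i.e. $\mu(A\cup B)=\mu(A)+\mu(B)$ for disjoint $A,B\in\mathcal F$. A Banach space $X$ has the SVM property if there is a constant $v<\infty$, depending only on $X$, such that for every set algebra $\mathcal F$ and every function $\nu\colon\mathcal F\to X$ satisfying $$\|\nu(A\cup B)-\nu(A)-\nu(B)\|\le 1\qquad\text{for all disjoint }A,B\in\mathcal F$$ there is a vector measure $\mu\colon\mathcal F\to X$ with $\|\nu(A)-\mu(A)\|\le v$ for all $A\in\mathcal F$. For a cardinal number $\kappa$, $X$ has the $\kappa$-SVM property if there is a constant $v<\infty$, depending only on $\kappa$ and $X$, such that the same holds for every set algebra $\mathcal F$ of cardinality less than $\kappa$. A property $\mathsf P$ of Banach spaces is a three-space property if, for every short exact sequence $0\to Y\to Z\to X\to 0$ of Banach spaces and bounded linear operators, $Z$ has $\mathsf P$ whenever both $Y$ and $X$ have $\mathsf P$. **Theorem.** If $\kappa$ is a cardinal number with uncountable cofinality, then the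 $\kappa$-SVM property is a three-space property. Consequently, the SVM property is a three-space property. -/

import Mathlib

open MeasureTheory

universe u v

/-- The set function `ν` is `ε`-additive on the family `F` of sets:
`‖ν (A ∪ B) - ν A - ν B‖ ≤ ε` for disjoint `A`, `B` in `F`.
Only the values of `ν` on members of `F` matter. -/
def IsEpsAdditiveOn {Ω : Type v} {E : Type u} [NormedAddCommGroup E]
    (F : Set (Set Ω)) (ε : ℝ) (ν : Set Ω → E) : Prop :=
  ∀ A ∈ F, ∀ B ∈ F, Disjoint A B → ‖ν (A ∪ B) - ν A - ν B‖ ≤ ε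

/-- The set function `μ` is a (finitely additive) vector measure on the family `F` of sets.
Only the values of `μ` on members of `F` matter. -/
def IsVectorMeasureOn {Ω : Type v} {E : Type u} [NormedAddCommGroup E]
    (F : Set (Set Ω)) (μ : Set Ω → E) : Prop :=
  ∀ A ∈ F, ∀ B ∈ F, Disjoint A B → μ (A ∪ B) = μ A + μ B

/-- The SVM (stability of vector measures) property: one constant `c` such that, for every set
algebra, every `1`-additive function is within `c` of a vector measure. -/
def HasSVM (E : Type u) [NormedAddCommGroup E] : Prop :=
  ∃ c : ℝ, ∀ (Ω : Type v) (F : Set (Set Ω)), IsSetAlgebra F →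
    ∀ ν : Set Ω → E, IsEpsAdditiveOn F 1 ν →
      ∃ μ : Set Ω → E, IsVectorMeasureOn F μ ∧ ∀ A ∈ F, ‖ν A - μ A‖ ≤ c

/-- The `κ`-SVM property: one constant `c` such that, for every set algebra of cardinality less
than `κ`, every `1`-additive function is within `c` of a vector measure.
By Stone's representation theorem, an algebra with fewer than `κ : Cardinal.{v}` members is
isomorphic to an algebra of subsets of some `Ω : Type v`, so no algebra is lost by taking `Ω`
in the universe of `κ`. -/
def HasKappaSVM (κ : Cardinal.{v}) (E : Type u) [NormedAddCommGroup E] : Prop :=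
  ∃ c : ℝ, ∀ (Ω : Type v) (F : Set (Set Ω)), IsSetAlgebra F → Cardinal.mk F < κ →
    ∀ ν : Set Ω → E, IsEpsAdditiveOn F 1 ν →
      ∃ μ : Set Ω → E, IsVectorMeasureOn F μ ∧ ∀ A ∈ F, ‖ν A - μ A‖ ≤ c

/-- `P` is a three-space property of Banach spaces: for every short exact sequence
`0 → Y → Z → X → 0` of Banach spaces and bounded operators, if `Y` and `X` have `P`,
then so does `Z`. -/
def IsThreeSpaceProperty
    (P : ∀ (E : Type u) [NormedAddCommGroup E] [NormedSpace ℝ E], Prop) : Prop :=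
  ∀ (Y Z X : Type u)
    [NormedAddCommGroup Y] [NormedSpace ℝ Y] [CompleteSpace Y]
    [NormedAddCommGroup Z] [NormedSpace ℝ Z] [CompleteSpace Z]
    [NormedAddCommGroup X] [NormedSpace ℝ X] [CompleteSpace X]
    (i : Y →L[ℝ] Z) (q : Z →L[ℝ] X),
    Function.Injective i → Function.Exact i q → Function.Surjective q →
      P Y → P X → P Z

/-! Given a 1-additive `ν` into `Z`, approximate `q ∘ ν` by a measure `m` in `X`. A small bounded
correction `w` makes `q (ν + w) = m`. Subtracting `s ∘ m`, with `s` an algebraic linear section of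
`q`, leaves a map into `ker q = i(Y)`. Since `s ∘ m` is exactly additive, it adds nothing to the
additivity defect, so `s` need not be bounded. Stability of `Y` then finishes the proof, on one
fixed algebra throughout. -/

/-- Every `1`-additive function on `F` is within `c` of a vector measure on `F`. -/
def IsStableOn {Ω : Type v} (F : Set (Set Ω)) (c : ℝ) (E : Type u) [NormedAddCommGroup E] : Prop :=
  ∀ ν : Set Ω → E, IsEpsAdditiveOn F 1 ν →
    ∃ μ : Set Ω → E, IsVectorMeasureOn F μ ∧ ∀ A ∈ F, ‖ν A - μ A‖ ≤ c

theorem IsStableOn.exists_of_epsAdditive {Ω : Type v} {F : Set (Set Ω)} {c : ℝ} {E : Type u}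
    [NormedAddCommGroup E] [NormedSpace ℝ E] (h : IsStableOn F c E) {ε : ℝ} (hε : 0 < ε)
    {ν : Set Ω → E} (hν : IsEpsAdditiveOn F ε ν) :
    ∃ μ : Set Ω → E, IsVectorMeasureOn F μ ∧ ∀ A ∈ F, ‖ν A - μ A‖ ≤ ε * c := by
  obtain ⟨μ, hμ, hb⟩ := h (fun A => ε⁻¹ • ν A) (fun A hA B hB hd => by
    rw [← smul_sub, ← smul_sub, norm_smul, Real.norm_of_nonneg (by positivity),
      inv_mul_le_iff₀ hε, mul_one]
    exact hν A hA B hB hd)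
  refine ⟨fun A => ε • μ A, fun A hA B hB hd => ?_, fun A hA => ?_⟩
  · simp only [hμ A hA B hB hd, smul_add]
  · have : ν A - ε • μ A = ε • (ε⁻¹ • ν A - μ A) := by
      rw [smul_sub, smul_inv_smul₀ hε.ne']
    rw [this, norm_smul, Real.norm_of_nonneg hε.le]
    exact mul_le_mul_of_nonneg_left (hb A hA) hε.le

/-- Stability on a set algebra passes to the middle of a short exact sequence, with a constant
that does not depend on the algebra. The key point is that a vector measure with values in the
quotient can be lifted by a (possibly discontinuous) linear section. -/
theorem exists_isStableOn_of_exact {Y Z X : Type u}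
    [NormedAddCommGroup Y] [NormedSpace ℝ Y] [CompleteSpace Y]
    [NormedAddCommGroup Z] [NormedSpace ℝ Z] [CompleteSpace Z]
    [NormedAddCommGroup X] [NormedSpace ℝ X] [CompleteSpace X]
    (i : Y →L[ℝ] Z) (q : Z →L[ℝ] X) (hi : Function.Injective i) (hiq : Function.Exact i q)
    (hq : Function.Surjective q) (cY cX : ℝ) :
    ∃ c : ℝ, ∀ (Ω : Type v) (F : Set (Set Ω)), IsSetAlgebra F →
      IsStableOn F cY Y → IsStableOn F cX X → IsStableOn F c Z := by
  have hrange : Set.range i = (q : Z → X) ⁻¹' {0} :=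
    Set.ext fun z => (hiq z).symm
  obtain ⟨K, hK⟩ := i.antilipschitz_of_injective_of_isClosed_range hi
    (hrange ▸ isClosed_singleton.preimage q.continuous)
  obtain ⟨C, hC, hlift⟩ := q.exists_preimage_norm_le hq
  choose g hg hgC using hlift
  obtain ⟨s, hs⟩ := (q : Z →ₗ[ℝ] X).exists_rightInverse_of_surjective
    (LinearMap.range_eq_top.2 hq)
  replace hs : ∀ x, q (s x) = x := fun x => LinearMap.congr_fun hs x
  -- `D` bounds `w`: `q ∘ ν` is `(‖q‖ + 1)`-additive, and `C` is the cost of a norm-controlled lift.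
  -- The `+ 1` keeps the scale positive even if `q = 0`.
  set D : ℝ := C * ((‖q‖ + 1) * |cX|) with hD
  have hD0 : 0 ≤ D := by positivity
  -- Defect of `t` below: 1 from `ν`, `D` from each of three values of `w`, times `K` for inverting
  -- `i` on its closed range; `+ 1` again ensures positivity.
  set ε : ℝ := K * (1 + 3 * D) + 1 with hεdef
  have hε : 0 < ε := by positivity
  refine ⟨‖i‖ * (ε * |cY|) + D, fun Ω F hF hY hX ν hν => ?_⟩
  obtain ⟨m, hm, hmb⟩ := hX.exists_of_epsAdditive (ε := ‖q‖ + 1) (by positivity)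
    (ν := fun A => q (ν A)) (fun A hA B hB hd => by
      rw [← map_sub, ← map_sub]
      refine (q.le_opNorm _).trans ?_
      have := mul_le_mul_of_nonneg_left (hν A hA B hB hd) (norm_nonneg q)
      linarith)
  -- The lift `g` is bounded but not linear, so it is applied only to the small error `m - q ∘ ν`;
  -- the additive but possibly unbounded `s` lifts `m` itself.
  let w : Set Ω → Z := fun A => g (m A - q (ν A))
  have hw : ∀ A ∈ F, ‖w A‖ ≤ D := fun A hA => by
    refine (hgC _).trans (mul_le_mul_of_nonneg_left ?_ hC.le)
    rw [norm_sub_rev]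
    exact (hmb A hA).trans (mul_le_mul_of_nonneg_left (le_abs_self _) (by positivity))
  have hker : ∀ A, ∃ y, i y = ν A + w A - s (m A) := fun A =>
    (hiq _).1 (by simp [w, hg, hs])
  choose t ht using hker
  have htadd : IsEpsAdditiveOn F ε t := fun A hA B hB hd => by
    have hU := hF.union_mem hA hB
    have h1 : i (t (A ∪ B) - t A - t B) =
        (ν (A ∪ B) - ν A - ν B) + (w (A ∪ B) - w A - w B) := by
      simp only [map_sub, ht, hm A hA B hB hd, map_add]
      abel
    have h2 : ‖i (t (A ∪ B) - t A - t B)‖ ≤ 1 + 3 * D := by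
      rw [h1]
      have := norm_add_le (ν (A ∪ B) - ν A - ν B) (w (A ∪ B) - w A - w B)
      have := norm_sub_le (w (A ∪ B) - w A) (w B)
      have := norm_sub_le (w (A ∪ B)) (w A)
      linarith [hν A hA B hB hd, hw _ hU, hw A hA, hw B hB]
    have h3 := hK.le_mul_norm (map_zero i) (t (A ∪ B) - t A - t B)
    have := mul_le_mul_of_nonneg_left h2 K.coe_nonneg
    linarith
  obtain ⟨l, hl, hlb⟩ := hY.exists_of_epsAdditive hε htadd
  refine ⟨fun A => s (m A) + i (l A), fun A hA B hB hd => ?_, fun A hA => ?_⟩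
  · simp only [hm A hA B hB hd, hl A hA B hB hd, map_add]
    abel
  · have h1 : ν A - (s (m A) + i (l A)) = i (t A - l A) - w A := by
      rw [map_sub, ht]
      abel
    rw [h1]
    refine (norm_sub_le _ _).trans (add_le_add ?_ (hw A hA))
    refine (i.le_opNorm _).trans (mul_le_mul_of_nonneg_left ?_ (norm_nonneg i))
    exact (hlb A hA).trans (mul_le_mul_of_nonneg_left (le_abs_self _) hε.le)

theorem theorem7p1 :
    (∀ κ : Cardinal.{v}, Cardinal.aleph0 < κ.ord.cof →
      IsThreeSpaceProperty.{u} (fun E _ _ => HasKappaSVM.{u, v} κ E)) ∧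
    IsThreeSpaceProperty.{u} (fun E _ _ => HasSVM.{u, v} E) := by
  refine ⟨fun κ _ => ?_, ?_⟩
  · intro Y Z X _ _ _ _ _ _ _ _ _ i q hi hiq hq ⟨cY, hY⟩ ⟨cX, hX⟩
    obtain ⟨c, hc⟩ := exists_isStableOn_of_exact.{u, v} i q hi hiq hq cY cX
    exact ⟨c, fun Ω F hF hκ => hc Ω F hF (hY Ω F hF hκ) (hX Ω F hF hκ)⟩
  · intro Y Z X _ _ _ _ _ _ _ _ _ i q hi hiq hq ⟨cY, hY⟩ ⟨cX, hX⟩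
    obtain ⟨c, hc⟩ := exists_isStableOn_of_exact.{u, v} i q hi hiq hq cY cX
    exact ⟨c, fun Ω F hF => hc Ω F hF (hY Ω F hF) (hX Ω F hF)⟩
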